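/- There is an absolute constant $\epsilon_0>0$ with the following property. Let $0<\epsilon<\epsilon_0$ and let $E\subset\mathbb{R}^2$ be a (Lebesgue) measurable set with $|E|=1$ that is contained in a square (in any position and orientation) of side length $1+\epsilon$. Suppose that $E$ tiles $\mathbb{R}^2$ by translations, i.e. there is a discrete set $T\subset\mathbb{R}^2$ such that, up to sets of measure $0$, the translates $E+t$, $t\in T$, are mutually disjoint and $\bigcup_{t\in T}(E+t)=\mathbb{R}^2$. Then $E$ also admits a lattice tiling, i.e. a tiling by translations whose translation set is of the form $A\mathbb{Z}^2$ with $A$ an invertible linear transformation of $\mathbb{R}^2$. Consequently $E$ is spectral: there is a discrete set $\Lambda\subset\mathbb{R}^2$ such that the exponentials $x\mapsto e^{2\pi i\lambda\cdot x}$, $\lambda\in\Lambda$, form an orthogonal basis of $L^2(E)$. -/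

import Mathlib

open MeasureTheory
open scoped Pointwise ENNReal

/-- `E + T = ℝⁿ` is a tiling: `T` is discrete and, up to sets of Lebesgue measure zero, the
translates `E + t`, `t ∈ T`, are mutually disjoint and cover `ℝⁿ`. -/
def IsTiling {n : ℕ} (E T : Set (EuclideanSpace ℝ (Fin n))) : Prop :=
  DiscreteTopology T ∧
    (∀ s ∈ T, ∀ t ∈ T, s ≠ t → volume ((s +ᵥ E) ∩ (t +ᵥ E)) = 0) ∧
    volume (⋃ t ∈ T, (t +ᵥ E))ᶜ = 0

/-- `E` tiles `ℝⁿ` by translations. -/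
def TilesByTranslations {n : ℕ} (E : Set (EuclideanSpace ℝ (Fin n))) : Prop :=
  ∃ T : Set (EuclideanSpace ℝ (Fin n)), IsTiling E T

/-- A lattice in `ℝⁿ`: the image of `ℤⁿ` under an invertible linear transformation. -/
def IsFullLattice {n : ℕ} (L : Set (EuclideanSpace ℝ (Fin n))) : Prop :=
  ∃ A : EuclideanSpace ℝ (Fin n) ≃ₗ[ℝ] EuclideanSpace ℝ (Fin n),
    L = A '' {x | ∀ i, ∃ k : ℤ, x i = (k : ℝ)}

/-- `E` admits a lattice tiling. -/
def AdmitsLatticeTiling {n : ℕ} (E : Set (EuclideanSpace ℝ (Fin n))) : Prop :=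
  ∃ L : Set (EuclideanSpace ℝ (Fin n)), IsFullLattice L ∧ IsTiling E L

/-- The exponential `x ↦ exp (2 π i ⟨ξ, x⟩)` with frequency `ξ`. -/
noncomputable def expWave {n : ℕ} (ξ x : EuclideanSpace ℝ (Fin n)) : ℂ :=
  Complex.exp (2 * (Real.pi : ℂ) * Complex.I * ((inner ℝ ξ x : ℝ) : ℂ))

/-- `S` is a spectrum for `E`: `S` is discrete and the exponentials with frequencies in `S`
form an orthogonal basis of the Hilbert space `L²(E)`, that is, they are nonzero, pairwise
orthogonal elements of `L²(E)` whose closed linear span is the whole space. -/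
def IsSpectrum {n : ℕ} (E S : Set (EuclideanSpace ℝ (Fin n))) : Prop :=
  DiscreteTopology S ∧
    ∃ hmem : ∀ ξ : S, MemLp (expWave (ξ : EuclideanSpace ℝ (Fin n))) 2 (volume.restrict E),
      (∀ ξ : S, (hmem ξ).toLp ≠ 0) ∧
      (∀ ξ η : S, ξ ≠ η → inner ℂ (hmem ξ).toLp (hmem η).toLp = 0) ∧
      (Submodule.span ℂ (Set.range fun ξ : S => (hmem ξ).toLp)).topologicalClosure = ⊤

/-- `E` is a spectral set. -/
def IsSpectral {n : ℕ} (E : Set (EuclideanSpace ℝ (Fin n))) : Prop :=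
  ∃ S : Set (EuclideanSpace ℝ (Fin n)), IsSpectrum E S

/-- `Q` is a (closed, solid) square of side length `s` in the plane, in arbitrary position
and orientation: a congruent copy of `[0, s] × [0, s]`. -/
def IsPlaneSquare (s : ℝ) (Q : Set (EuclideanSpace ℝ (Fin 2))) : Prop :=
  ∃ φ : EuclideanSpace ℝ (Fin 2) ≃ᵢ EuclideanSpace ℝ (Fin 2),
    Q = φ '' {x | ∀ i, x i ∈ Set.Icc (0 : ℝ) s}

/-!
# Near-square translational tiles of the plane admit lattice tilings

In coordinates adapted to the square, `E` lies in a centred square of side `1 + ε`, and comparing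
areas shows that distinct translation vectors are at sup distance at least `0.99`
(`sup_norm_separation`), so the tiling looks locally like a tiling by unit squares. Up to a symmetry
of the square, it therefore contains four tiles, at `0`, `v` (above `0`), `u` (to the right of `0`)
and `u + w` (above `u`), which surround a common quadrilateral (`latticeTiles_of_zero_mem`).

The decisive point is that `v = w` exactly (`displacement_eq`). Over a short interval of abscissae,
the tile at `0` and the tile at `v` fill a rectangle reaching from one centre to the other, so that
`v.2` is determined by the area of the upper part of `E` over the interval and the area of the lower
part of `E` over the interval shifted by `-v.1` (`vertical_junction`). The same holds for `w`.
Since `E` contains almost all of the square up to a thin layer along its boundary, the area over a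
shifted interval changes by much less than the shift, whence `|v.2 - w.2| ≤ κ |v.1 - w.1|` with a
small `κ` (`abs_snd_sub_le`). The horizontal junctions `0, u` and `v, u + w` give the same inequality
with the coordinates exchanged, so both sides vanish.

Now `0, v, u, u + v` are translation vectors, and `ℤ u + ℤ v` tiles with `E`
(`latticeTiles_of_parallelogram`): a lattice vector along which the two squares overlap is a
difference of two of these four vectors, which gives a packing, and the parallelogram on `u, v` is
met only by these four tiles, hence is covered by them, and so is the plane by the lattice translates.

A lattice tile is spectral with the dual lattice as spectrum (`AdmitsLatticeTiling.isSpectral`). The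
characters are orthogonal because translating a fundamental domain does not change the integral of a
periodic function. They are complete because the projection of `E` to the torus `ℝⁿ / A ℤⁿ` is
injective up to a null set, so that every function in `L²(E)` comes from the torus, where
trigonometric polynomials are dense.
-/

/-! ### Tilings by near-squares in coordinates -/

/-- A tiling of the plane by the translates `t + E`, `t ∈ T`, of a subset of a centred square of
side `1.01`, such that distinct translation vectors are at distance at least `0.99` in the sup norm.
For a tile of area `1` the separation holds automatically if the square has side close to `1`, see
`sup_norm_separation`; the area plays no other role. -/
structure NearSquareTiling (E T : Set (ℝ × ℝ)) : Prop where
  nullMeasurableSet : NullMeasurableSet E volume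
  mem_box : ∀ p ∈ E, |p.1| ≤ 101 / 200 ∧ |p.2| ≤ 101 / 200
  countable : T.Countable
  sep : ∀ s ∈ T, ∀ t ∈ T, s ≠ t → 99 / 100 ≤ |s.1 - t.1| ∨ 99 / 100 ≤ |s.2 - t.2|
  aedisjoint : ∀ s ∈ T, ∀ t ∈ T, s ≠ t → volume {p | p - s ∈ E ∧ p - t ∈ E} = 0
  covers : ∀ᵐ p : ℝ × ℝ, ∃ t ∈ T, p - t ∈ E

/-- `E` tiles with a lattice `ℤ u + ℤ v`, where `u` and `v` are linearly independent. -/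
def LatticeTiles {V : Type*} [AddCommGroup V] [Module ℝ V] [MeasureSpace V] (E : Set V) : Prop :=
  ∃ u v : V, LinearIndependent ℝ ![u, v] ∧
    (∀ i j : ℤ, (i, j) ≠ (0, 0) → volume {p | p ∈ E ∧ p - (i • u + j • v) ∈ E} = 0) ∧
    ∀ᵐ p : V, ∃ i j : ℤ, p - (i • u + j • v) ∈ E

theorem LatticeTiles.of_preimage {V W : Type*} [AddCommGroup V] [Module ℝ V] [MeasureSpace V]
    [AddCommGroup W] [Module ℝ W] [MeasureSpace W] (g : V ≃ₗ[ℝ] W)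
    (hg : MeasurePreserving g.symm) {E : Set W} (h : LatticeTiles (g ⁻¹' E)) :
    LatticeTiles E := by
  obtain ⟨u, v, huv, hd, hc⟩ := h
  refine ⟨g u, g v, ?_, fun i j hij => ?_, ?_⟩
  · have hcomp : ![g u, g v] = g ∘ ![u, v] := by
      funext i
      fin_cases i <;> rfl
    rw [hcomp]
    exact huv.map' g.toLinearMap g.ker
  · convert hg.quasiMeasurePreserving.preimage_null (hd i j hij) using 2
    ext p
    simp
  · filter_upwards [hg.quasiMeasurePreserving.ae hc] with p ⟨i, j, hp⟩
    exact ⟨i, j, by simpa using hp⟩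

namespace NearSquareTiling

variable {E T : Set (ℝ × ℝ)}

/-- Invariance under the symmetries of the square. -/
theorem preimage (h : NearSquareTiling E T) (g : (ℝ × ℝ) ≃ₗ[ℝ] (ℝ × ℝ))
    (hg : MeasurePreserving g)
    (hcoord : ∀ p, (|p.1| = |(g p).1| ∧ |p.2| = |(g p).2|) ∨
      (|p.1| = |(g p).2| ∧ |p.2| = |(g p).1|)) :
    NearSquareTiling (g ⁻¹' E) (g ⁻¹' T) where
  nullMeasurableSet := h.nullMeasurableSet.preimage hg.quasiMeasurePreserving
  mem_box p hp := by
    have := h.mem_box _ hp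
    rcases hcoord p with ⟨h1, h2⟩ | ⟨h1, h2⟩ <;> rw [h1, h2] <;> tauto
  countable := h.countable.preimage g.injective
  sep s hs t ht hst := by
    have := h.sep _ hs _ ht (g.injective.ne hst)
    rw [← Prod.fst_sub, ← Prod.snd_sub, ← map_sub] at this
    rw [← Prod.fst_sub, ← Prod.snd_sub]
    rcases hcoord (s - t) with ⟨h1, h2⟩ | ⟨h1, h2⟩ <;> rw [h1, h2] <;> tauto
  aedisjoint s hs t ht hst := by
    convert hg.quasiMeasurePreserving.preimage_null
      (h.aedisjoint _ hs _ ht (g.injective.ne hst)) using 2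
    ext p
    simp
  covers := by
    filter_upwards [hg.quasiMeasurePreserving.ae h.covers] with p ⟨t, ht, hp⟩
    exact ⟨g.symm t, by simpa using ht, by simpa using hp⟩

/-- The reflection in the first coordinate axis. -/
def reflection : (ℝ × ℝ) ≃ₗ[ℝ] (ℝ × ℝ) := (LinearEquiv.refl ℝ ℝ).prodCongr (LinearEquiv.neg ℝ)

theorem measurePreserving_reflection : MeasurePreserving reflection :=
  (MeasurePreserving.id (volume : Measure ℝ)).prod (Measure.measurePreserving_neg volume)

theorem measurePreserving_prodComm : MeasurePreserving (LinearEquiv.prodComm ℝ ℝ ℝ) :=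
  Measure.measurePreserving_swap (μ := (volume : Measure ℝ)) (ν := volume)

theorem swap (h : NearSquareTiling E T) :
    NearSquareTiling (LinearEquiv.prodComm ℝ ℝ ℝ ⁻¹' E) (LinearEquiv.prodComm ℝ ℝ ℝ ⁻¹' T) :=
  h.preimage _ measurePreserving_prodComm fun _ => .inr ⟨rfl, rfl⟩

theorem reflect (h : NearSquareTiling E T) :
    NearSquareTiling (reflection ⁻¹' E) (reflection ⁻¹' T) :=
  h.preimage _ measurePreserving_reflection fun _ => .inl ⟨rfl, (abs_neg _).symm⟩

theorem translate (h : NearSquareTiling E T) (c : ℝ × ℝ) :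
    NearSquareTiling E {p | p + c ∈ T} where
  nullMeasurableSet := h.nullMeasurableSet
  mem_box := h.mem_box
  countable := h.countable.preimage (add_left_injective c)
  sep s hs t ht hst := by
    simpa using h.sep _ hs _ ht ((add_left_injective c).ne hst)
  aedisjoint s hs t ht hst := by
    have h0 := h.aedisjoint _ hs _ ht ((add_left_injective c).ne hst)
    convert (measurePreserving_add_right volume c).quasiMeasurePreserving.preimage_null h0 using 2
    ext p
    simp
  covers := by
    filter_upwards [(measurePreserving_add_right volume c).quasiMeasurePreserving.ae h.covers]
      with p ⟨t, ht, hp⟩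
    refine ⟨t - c, by simpa using ht, ?_⟩
    rwa [sub_sub_eq_add_sub]

theorem sep_cases (h : NearSquareTiling E T) {s t : ℝ × ℝ} (hs : s ∈ T) (ht : t ∈ T) :
    s = t ∨ s.1 - t.1 ≤ -(99 / 100) ∨ 99 / 100 ≤ s.1 - t.1 ∨
      s.2 - t.2 ≤ -(99 / 100) ∨ 99 / 100 ≤ s.2 - t.2 := by
  rw [or_iff_not_imp_left]
  intro hst
  rcases h.sep s hs t ht hst with h | h <;> rcases le_abs'.1 h with h | h <;> simp [h]

/-- By separation, only finitely many translates meet a bounded region. -/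
theorem finite_near (h : NearSquareTiling E T) (p : ℝ × ℝ) :
    {t ∈ T | |p.1 - t.1| ≤ 1 ∧ |p.2 - t.2| ≤ 1}.Finite := by
  have hinj : Set.InjOn (fun t : ℝ × ℝ => (⌊2 * t.1⌋, ⌊2 * t.2⌋))
      {t ∈ T | |p.1 - t.1| ≤ 1 ∧ |p.2 - t.2| ≤ 1} := by
    rintro s ⟨hs, -⟩ t ⟨ht, -⟩ hst
    simp only [Prod.mk.injEq] at hst
    have h1 := abs_lt.1 (Int.abs_sub_lt_one_of_floor_eq_floor hst.1)
    have h2 := abs_lt.1 (Int.abs_sub_lt_one_of_floor_eq_floor hst.2)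
    rcases h.sep_cases hs ht with h | h | h | h | h
    · exact h
    all_goals linarith
  refine Set.Finite.of_injOn (t := Set.Icc ⌊2 * (p.1 - 1)⌋ ⌊2 * (p.1 + 1)⌋ ×ˢ
    Set.Icc ⌊2 * (p.2 - 1)⌋ ⌊2 * (p.2 + 1)⌋) ?_ hinj
    ((Set.finite_Icc _ _).prod (Set.finite_Icc _ _))
  rintro t ⟨-, h1, h2⟩
  rw [abs_le] at h1 h2
  exact ⟨⟨Int.floor_le_floor (by linarith), Int.floor_le_floor (by linarith)⟩,
    Int.floor_le_floor (by linarith), Int.floor_le_floor (by linarith)⟩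

/-- The closed squares around the translation vectors cover the plane without exception: an uncovered
point would have an uncovered neighbourhood. -/
theorem exists_near (h : NearSquareTiling E T) (p : ℝ × ℝ) :
    ∃ t ∈ T, |p.1 - t.1| ≤ 101 / 200 ∧ |p.2 - t.2| ≤ 101 / 200 := by
  by_contra! hcon
  set F := {t ∈ T | |p.1 - t.1| ≤ 1 ∧ |p.2 - t.2| ≤ 1} with hF
  set C : Set (ℝ × ℝ) := ⋃ t ∈ F, {q | |q.1 - t.1| ≤ 101 / 200 ∧ |q.2 - t.2| ≤ 101 / 200} with hC
  have hclosed : IsClosed C := by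
    refine (h.finite_near p).isClosed_biUnion fun t _ => ?_
    have h1 : IsClosed {q : ℝ × ℝ | |q.1 - t.1| ≤ 101 / 200} :=
      isClosed_le (by fun_prop) continuous_const
    have h2 : IsClosed {q : ℝ × ℝ | |q.2 - t.2| ≤ 101 / 200} :=
      isClosed_le (by fun_prop) continuous_const
    exact h1.inter h2
  have hpC : p ∉ C := by
    simp only [hC, Set.mem_iUnion, not_exists]
    intro t ht hp
    exact absurd hp.2 (not_le.2 (hcon t ht.1 hp.1))
  set U := Cᶜ ∩ Metric.ball p (1 / 10) with hU
  have hUo : IsOpen U := hclosed.isOpen_compl.inter Metric.isOpen_ball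
  have hpU : p ∈ U := ⟨hpC, Metric.mem_ball_self (by norm_num)⟩
  have hpos : volume U ≠ 0 := (hUo.measure_pos volume ⟨p, hpU⟩).ne'
  refine hpos (measure_mono_null (fun q hq => ?_) (ae_iff.1 h.covers))
  rintro ⟨t, ht, hqt⟩
  have hb := h.mem_box _ hqt
  have hd := hq.2
  rw [Metric.mem_ball, Prod.dist_eq, max_lt_iff, Real.dist_eq, Real.dist_eq, abs_lt, abs_lt] at hd
  refine hq.1 (Set.mem_biUnion (x := t) ⟨ht, ?_, ?_⟩ hb)
  · have := abs_le.1 hb.1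
    rw [Prod.fst_sub] at this
    exact abs_le.2 ⟨by linarith, by linarith⟩
  · have := abs_le.1 hb.2
    rw [Prod.snd_sub] at this
    exact abs_le.2 ⟨by linarith, by linarith⟩

/-! ### The tile near its core and along its edges -/

theorem ae_mem_core (h : NearSquareTiling E T) (h0 : 0 ∈ T) :
    ∀ᵐ p : ℝ × ℝ, |p.1| ≤ 46 / 100 → |p.2| ≤ 46 / 100 → p ∈ E := by
  filter_upwards [h.covers] with p ⟨t, ht, hp⟩ h1 h2
  have hb := h.mem_box _ hp
  rw [Prod.fst_sub, Prod.snd_sub, abs_le, abs_le] at hb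
  rw [abs_le] at h1 h2
  rcases h.sep_cases ht h0 with rfl | h | h | h | h
  · simpa using hp
  all_goals
    simp only [Prod.fst_zero, Prod.snd_zero] at h
    linarith

/-- The two tiles `E` and `v + E`, one above the other, fill the rectangle over `(a, b]` between the
heights of their centres. -/
theorem vertical_junction (h : NearSquareTiling E T) (h0 : 0 ∈ T) {v : ℝ × ℝ} (hv : v ∈ T)
    (hv2 : |v.2 - 1| ≤ 1 / 5) {a b : ℝ} (hab : a ≤ b) (ha : -(46 / 100) ≤ a) (hb : b ≤ 46 / 100)
    (hav : -(46 / 100) ≤ a - v.1) (hbv : b - v.1 ≤ 46 / 100) :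
    volume.real (E ∩ Set.Ioc a b ×ˢ Set.Icc 0 2) +
      volume.real (E ∩ Set.Ioc (a - v.1) (b - v.1) ×ˢ Set.Icc (-2) 0) = (b - a) * v.2 := by
  rw [abs_le] at hv2
  have hv0 : v ≠ 0 := by
    rintro rfl
    norm_num at hv2
  set R : Set (ℝ × ℝ) := Set.Ioc a b ×ˢ Set.Icc 0 v.2 with hR
  have hRmeas : MeasurableSet R := measurableSet_Ioc.prod measurableSet_Icc
  have hRfin : volume R ≠ ∞ := by
    rw [hR, Measure.volume_eq_prod, Measure.prod_prod]
    simp [ENNReal.mul_eq_top]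
  have hRvol : volume.real R = (b - a) * v.2 := by
    rw [hR, Measure.volume_eq_prod, measureReal_prod_prod, Real.volume_real_Ioc_of_le hab,
      Real.volume_real_Icc_of_le (by linarith), sub_zero]
  have hlow : E ∩ Set.Ioc a b ×ˢ Set.Icc 0 2 = R ∩ E := by
    ext p
    constructor
    · rintro ⟨hpE, hp1, hp2⟩
      have := abs_le.1 (h.mem_box p hpE).2
      exact ⟨⟨hp1, hp2.1, by linarith⟩, hpE⟩
    · rintro ⟨⟨hp1, hp2⟩, hpE⟩
      exact ⟨hpE, hp1, hp2.1, by linarith [hp2.2]⟩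
  have hup : volume (E ∩ Set.Ioc (a - v.1) (b - v.1) ×ˢ Set.Icc (-2) 0) =
      volume (R ∩ {p | p - v ∈ E}) := by
    rw [← measure_preimage_add_right volume (-v)]
    congr 1
    ext p
    constructor
    · rintro ⟨hpE, hp1, hp2⟩
      have hbox := abs_le.1 (h.mem_box _ hpE).2
      simp only [Set.mem_Ioc, Set.mem_Icc, Prod.fst_add, Prod.snd_add, Prod.fst_neg,
        Prod.snd_neg] at hp1 hp2 hbox
      refine ⟨⟨⟨by linarith, by linarith⟩, by linarith, by linarith⟩, ?_⟩
      simpa [sub_eq_add_neg] using hpE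
    · rintro ⟨⟨hp1, hp2⟩, hpE⟩
      simp only [Set.mem_Ioc, Set.mem_Icc] at hp1 hp2
      refine ⟨by simpa [sub_eq_add_neg] using hpE, ?_, ?_⟩
      · simp only [Set.mem_Ioc, Prod.fst_add, Prod.fst_neg]
        exact ⟨by linarith, by linarith⟩
      · simp only [Set.mem_Icc, Prod.snd_add, Prod.snd_neg]
        exact ⟨by linarith, by linarith⟩
  have hEv : NullMeasurableSet {p | p - v ∈ E} volume :=
    h.nullMeasurableSet.preimage (measurePreserving_sub_right volume v).quasiMeasurePreserving
  have hunion : volume ((R ∩ E) ∪ (R ∩ {p | p - v ∈ E})) = volume R := by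
    rw [← Set.inter_union_distrib_left]
    refine measure_congr (Filter.eventuallyEq_set.2 ?_)
    filter_upwards [h.covers] with p ⟨t, ht, hp⟩
    refine ⟨fun hpR => hpR.1, fun hpR => ⟨hpR, ?_⟩⟩
    have hbox := h.mem_box _ hp
    obtain ⟨hp1, hp2⟩ := hpR
    simp only [Set.mem_Ioc, Set.mem_Icc, Prod.fst_sub, Prod.snd_sub, abs_le] at hp1 hp2 hbox
    rcases h.sep_cases ht h0 with rfl | h1 | h1 | h1 | h1
    · exact .inl (by simpa using hp)
    all_goals
      rcases h.sep_cases ht hv with rfl | h2 | h2 | h2 | h2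
      · exact .inr hp
      all_goals
        simp only [Prod.fst_zero, Prod.snd_zero] at h1
        linarith
  have hdisj : AEDisjoint volume (R ∩ E) (R ∩ {p | p - v ∈ E}) := by
    refine measure_mono_null ?_ (h.aedisjoint 0 h0 v hv hv0.symm)
    rintro p ⟨hp1, hp2⟩
    exact ⟨by simpa using hp1.2, hp2.2⟩
  rw [measure_union₀ (hRmeas.nullMeasurableSet.inter hEv) hdisj] at hunion
  rw [hlow, ← hRvol, measureReal_def, measureReal_def, measureReal_def, hup, ← hunion,
    ENNReal.toReal_add (measure_ne_top_of_subset Set.inter_subset_left hRfin)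
      (measure_ne_top_of_subset Set.inter_subset_left hRfin)]

theorem volume_lower_half_ne_top (E : Set (ℝ × ℝ)) (a b : ℝ) :
    volume (E ∩ Set.Ioc a b ×ˢ Set.Icc (-2) 0) ≠ ∞ := by
  refine measure_ne_top_of_subset Set.inter_subset_right ?_
  rw [Measure.volume_eq_prod, Measure.prod_prod]
  simp [ENNReal.mul_eq_top]

theorem volume_lower_half_add (h : NearSquareTiling E T) {a b c : ℝ} (hab : a ≤ b) (hbc : b ≤ c) :
    volume.real (E ∩ Set.Ioc a c ×ˢ Set.Icc (-2) 0) =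
      volume.real (E ∩ Set.Ioc a b ×ˢ Set.Icc (-2) 0) +
      volume.real (E ∩ Set.Ioc b c ×ˢ Set.Icc (-2) 0) := by
  rw [← Set.Ioc_union_Ioc_eq_Ioc hab hbc, Set.union_prod, Set.inter_union_distrib_left]
  simp only [measureReal_def]
  rw [measure_union₀, ENNReal.toReal_add (volume_lower_half_ne_top _ _ _)
    (volume_lower_half_ne_top _ _ _)]
  · exact h.nullMeasurableSet.inter
      (measurableSet_Ioc.prod measurableSet_Icc).nullMeasurableSet
  · refine Disjoint.aedisjoint (Set.disjoint_left.2 ?_)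
    rintro p ⟨-, hp, -⟩ ⟨-, hp', -⟩
    exact absurd hp.2 (not_le.2 hp'.1)

/-- The lower half of the tile over a short interval has area proportional to the length of the
interval, with little uncertainty: the tile contains its core and is contained in the box. -/
theorem volume_lower_half_bounds (h : NearSquareTiling E T) (h0 : 0 ∈ T) {a b : ℝ} (hab : a ≤ b)
    (ha : -(46 / 100) ≤ a) (hb : b ≤ 46 / 100) :
    46 / 100 * (b - a) ≤ volume.real (E ∩ Set.Ioc a b ×ˢ Set.Icc (-2) 0) ∧
      volume.real (E ∩ Set.Ioc a b ×ˢ Set.Icc (-2) 0) ≤ 101 / 200 * (b - a) := by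
  have hrect : ∀ c : ℝ, 0 ≤ c →
      volume.real (Set.Ioc a b ×ˢ Set.Icc (-c) 0 : Set (ℝ × ℝ)) = c * (b - a) := by
    intro c hc
    rw [Measure.volume_eq_prod, measureReal_prod_prod, Real.volume_real_Ioc_of_le hab,
      Real.volume_real_Icc_of_le (by linarith)]
    ring
  have hfin : ∀ c : ℝ, volume (Set.Ioc a b ×ˢ Set.Icc (-c) 0 : Set (ℝ × ℝ)) ≠ ∞ := by
    intro c
    rw [Measure.volume_eq_prod, Measure.prod_prod]
    simp [ENNReal.mul_eq_top]
  constructor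
  · rw [← hrect _ (by norm_num)]
    refine ENNReal.toReal_mono (volume_lower_half_ne_top _ _ _) (measure_mono_ae ?_)
    filter_upwards [h.ae_mem_core h0] with p hp
    rintro ⟨h1, h2⟩
    simp only [Set.mem_Ioc, Set.mem_Icc] at h1 h2
    exact ⟨hp (abs_le.2 ⟨by linarith, by linarith⟩) (abs_le.2 ⟨by linarith, by linarith⟩), h1,
      by linarith, by linarith⟩
  · rw [← hrect _ (by norm_num)]
    refine measureReal_mono ?_ (hfin _)
    rintro p ⟨hpE, h1, h2⟩
    exact ⟨h1, (abs_le.1 (h.mem_box p hpE).2).1, h2.2⟩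

/-- Shifting the window changes the area of the lower half of the tile by much less than the shift. -/
theorem abs_volume_lower_half_sub_le (h : NearSquareTiling E T) (h0 : 0 ∈ T) {ℓ a a' : ℝ}
    (hℓ : 0 ≤ ℓ) (ha : -(46 / 100) ≤ a) (hb : a + ℓ ≤ 46 / 100) (ha' : -(46 / 100) ≤ a')
    (hb' : a' + ℓ ≤ 46 / 100) :
    |volume.real (E ∩ Set.Ioc a (a + ℓ) ×ˢ Set.Icc (-2) 0) -
      volume.real (E ∩ Set.Ioc a' (a' + ℓ) ×ˢ Set.Icc (-2) 0)| ≤ 45 / 1000 * |a - a'| := by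
  wlog haa : a ≤ a' generalizing a a'
  · rw [abs_sub_comm, abs_sub_comm a]
    exact this ha' hb' ha hb (le_of_not_ge haa)
  have e1 := h.volume_lower_half_add haa (show a' ≤ a' + ℓ by linarith)
  have e2 := h.volume_lower_half_add (show a ≤ a + ℓ by linarith)
    (show a + ℓ ≤ a' + ℓ by linarith)
  have b1 := h.volume_lower_half_bounds h0 haa ha (by linarith)
  have b2 := h.volume_lower_half_bounds h0 (show a + ℓ ≤ a' + ℓ by linarith) (by linarith) hb'
  rw [abs_sub_comm a, abs_of_nonneg (show 0 ≤ a' - a by linarith), abs_le]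
  constructor <;> linarith [b1.1, b1.2, b2.1, b2.2]

/-- Two pairs of vertically adjacent tiles: the vertical displacements differ by much less than the
horizontal ones. -/
theorem abs_snd_sub_le (h : NearSquareTiling E T) {s t v w : ℝ × ℝ} (hs : s ∈ T)
    (hsv : s + v ∈ T) (ht : t ∈ T) (htw : t + w ∈ T) (hv2 : |v.2 - 1| ≤ 1 / 5)
    (hw2 : |w.2 - 1| ≤ 1 / 5) {a ℓ : ℝ} (hℓ : 0 ≤ ℓ)
    (ha : -(46 / 100) ≤ a) (hb : a + ℓ ≤ 46 / 100)
    (hav : -(46 / 100) ≤ a - v.1) (hbv : a + ℓ - v.1 ≤ 46 / 100)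
    (haw : -(46 / 100) ≤ a - w.1) (hbw : a + ℓ - w.1 ≤ 46 / 100) :
    ℓ * |v.2 - w.2| ≤ 45 / 1000 * |v.1 - w.1| := by
  have hzero : (0 : ℝ × ℝ) ∈ {p | p + s ∈ T} := by simpa using hs
  have hzero' : (0 : ℝ × ℝ) ∈ {p | p + t ∈ T} := by simpa using ht
  have j1 := (h.translate s).vertical_junction hzero (v := v) (by simpa [add_comm] using hsv) hv2
    (show a ≤ a + ℓ by linarith) ha hb hav hbv
  have j2 := (h.translate t).vertical_junction hzero' (v := w) (by simpa [add_comm] using htw) hw2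
    (show a ≤ a + ℓ by linarith) ha hb haw hbw
  have key := (h.translate s).abs_volume_lower_half_sub_le hzero hℓ hav (by linarith) haw
    (by linarith)
  rw [show a + ℓ - v.1 = a - v.1 + ℓ by ring] at j1
  rw [show a + ℓ - w.1 = a - w.1 + ℓ by ring] at j2
  have e : volume.real (E ∩ Set.Ioc (a - v.1) (a - v.1 + ℓ) ×ˢ Set.Icc (-2) 0) -
      volume.real (E ∩ Set.Ioc (a - w.1) (a - w.1 + ℓ) ×ˢ Set.Icc (-2) 0) =
      ℓ * (v.2 - w.2) := by linarith
  rw [e, abs_mul, abs_of_nonneg hℓ, show a - v.1 - (a - w.1) = -(v.1 - w.1) by ring, abs_neg] at key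
  exact key

/-! ### Four adjacent tiles determine a lattice tiling -/

/-- The vertical displacements in two horizontally adjacent vertical pairs `0, v` and `u, u + w`
agree. Comparing the vertical junctions bounds the second coordinate of `v - w` by a small multiple
of the first one; comparing the horizontal junctions `0, u` and `v, u + w` does the opposite. -/
theorem displacement_eq (h : NearSquareTiling E T) {u v w : ℝ × ℝ} (h0 : 0 ∈ T) (hv : v ∈ T)
    (hu : u ∈ T) (huw : u + w ∈ T) (hv1 : |v.1| ≤ 3 / 100) (hv2 : |v.2 - 1| ≤ 3 / 100)
    (hu1 : |u.1 - 1| ≤ 3 / 100) (hu2 : |u.2| ≤ 51 / 100) (hw1 : |w.1| ≤ 7 / 100)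
    (hw2 : |w.2 - 1| ≤ 9 / 100) : v = w := by
  have hv1' := abs_le.1 hv1
  have hu1' := abs_le.1 hu1
  have hu2' := abs_le.1 hu2
  have hw1' := abs_le.1 hw1
  have k1 := h.abs_snd_sub_le (v := v) (w := w) h0 (by simpa using hv) hu huw
    (hv2.trans (by norm_num)) (hw2.trans (by norm_num)) (a := -(1 / 4)) (ℓ := 1 / 2) (by norm_num)
    (by norm_num) (by norm_num) (by linarith) (by linarith) (by linarith) (by linarith)
  have hvw1 : |v.1 - w.1| ≤ 1 / 10 := abs_le.2 ⟨by linarith, by linarith⟩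
  have hvw2 := abs_le.1 (show |v.2 - w.2| ≤ 1 / 100 by linarith)
  have k2 := h.swap.abs_snd_sub_le (s := 0) (t := v.swap) (v := u.swap) (w := (u + w - v).swap)
    (by simpa using h0) (by simpa using hu) hv
    (by
      change v + (u + w - v) ∈ T
      rwa [add_sub_cancel])
    (hu1.trans (by norm_num))
    (by
      change |u.1 + w.1 - v.1 - 1| ≤ 1 / 5
      exact abs_le.2 ⟨by linarith, by linarith⟩)
    (a := u.2 / 2 - 1 / 10) (ℓ := 1 / 5) (by norm_num) (by linarith) (by linarith)
    (by simp only [Prod.fst_swap]; linarith) (by simp only [Prod.fst_swap]; linarith)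
    (by simp only [Prod.fst_swap, Prod.snd_sub, Prod.snd_add]; linarith)
    (by simp only [Prod.fst_swap, Prod.snd_sub, Prod.snd_add]; linarith)
  simp only [Prod.fst_swap, Prod.snd_swap, Prod.snd_sub, Prod.snd_add, Prod.fst_sub,
    Prod.fst_add] at k2
  rw [show u.1 - (u.1 + w.1 - v.1) = v.1 - w.1 by ring,
    show u.2 - (u.2 + w.2 - v.2) = v.2 - w.2 by ring] at k2
  have p1 := abs_nonneg (v.1 - w.1)
  have p2 := abs_nonneg (v.2 - w.2)
  exact Prod.ext (sub_eq_zero.1 (abs_eq_zero.1 (by linarith)))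
    (sub_eq_zero.1 (abs_eq_zero.1 (by linarith)))

theorem aedisjoint_sub (h : NearSquareTiling E T) {s t : ℝ × ℝ} (hs : s ∈ T) (ht : t ∈ T)
    (hst : s ≠ t) : volume {p | p ∈ E ∧ p - (s - t) ∈ E} = 0 := by
  convert (measurePreserving_add_right volume t).quasiMeasurePreserving.preimage_null
    (h.aedisjoint t ht s hs hst.symm) using 2
  ext p
  simp [sub_sub_eq_add_sub]

/-- A square of side `1.01` around `(x, y)`, where `(x, y)` is at sup distance at least `0.99` from
the vertices of the parallelogram spanned by `u` and `v`, does not meet the half of the parallelogram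
next to the side `v`. -/
theorem not_meets_half_parallelogram {u₁ u₂ v₁ v₂ s r x y : ℝ} (hv1 : |v₁| ≤ 3 / 100)
    (hv2 : |v₂ - 1| ≤ 3 / 100) (hu1 : |u₁ - 1| ≤ 3 / 100) (hu2 : |u₂| ≤ 51 / 100)
    (hs0 : 0 ≤ s) (hs1 : s ≤ 1 / 2) (hr0 : 0 ≤ r) (hr1 : r ≤ 1)
    (hx : |s * u₁ + r * v₁ - x| ≤ 101 / 200) (hy : |s * u₂ + r * v₂ - y| ≤ 101 / 200)
    (h1 : 99 / 100 ≤ |x| ∨ 99 / 100 ≤ |y|)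
    (h2 : 99 / 100 ≤ |x - v₁| ∨ 99 / 100 ≤ |y - v₂|)
    (h3 : 99 / 100 ≤ |x - u₁| ∨ 99 / 100 ≤ |y - u₂|)
    (h4 : 99 / 100 ≤ |x - (u₁ + v₁)| ∨ 99 / 100 ≤ |y - (u₂ + v₂)|) : False := by
  rw [abs_le] at hv1 hv2 hu1 hu2 hx hy
  have a1 : s * u₁ ≤ 103 / 100 * s := by nlinarith
  have a2 : 97 / 100 * s ≤ s * u₁ := by nlinarith
  have a3 : r * v₁ ≤ 3 / 100 := by nlinarith
  have a4 : -(3 / 100) ≤ r * v₁ := by nlinarith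
  have a5 : s * u₂ ≤ 51 / 100 * s := by nlinarith
  have a6 : -(51 / 100) * s ≤ s * u₂ := by nlinarith
  have a7 : r * v₂ ≤ 103 / 100 := by nlinarith
  have a8 : 0 ≤ r * v₂ := by nlinarith
  have a9 : (1 - s) * u₂ ≤ 51 / 100 * (1 - s) := by nlinarith
  have a10 : -(51 / 100) * (1 - s) ≤ (1 - s) * u₂ := by nlinarith
  have hx' : 96 / 100 ≤ x := by
    rcases h1 with h1 | h1
    · rcases le_abs'.1 h1 with h1 | h1 <;> linarith
    · rcases le_abs'.1 h1 with h1 | h1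
      · linarith
      · rcases h2 with h2 | h2 <;> rcases le_abs'.1 h2 with h2 | h2 <;> linarith
  have hy3 : 99 / 100 ≤ y - u₂ := by
    rcases h3 with h3 | h3 <;> rcases le_abs'.1 h3 with h3 | h3 <;> linarith
  rcases h4 with h4 | h4 <;> rcases le_abs'.1 h4 with h4 | h4 <;> linarith

/-- Only the four tiles at the vertices of the parallelogram spanned by `u` and `v` meet it. -/
theorem mem_vertices_of_meets (h : NearSquareTiling E T) {u v t q : ℝ × ℝ} (h0 : 0 ∈ T)
    (hv : v ∈ T) (hu : u ∈ T) (huv : u + v ∈ T) (hv1 : |v.1| ≤ 3 / 100)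
    (hv2 : |v.2 - 1| ≤ 3 / 100) (hu1 : |u.1 - 1| ≤ 3 / 100) (hu2 : |u.2| ≤ 51 / 100) {s r : ℝ}
    (hs0 : 0 ≤ s) (hs1 : s ≤ 1) (hr0 : 0 ≤ r) (hr1 : r ≤ 1) (hq : q = s • u + r • v)
    (ht : t ∈ T) (hqt : q - t ∈ E) : t = 0 ∨ t = v ∨ t = u ∨ t = u + v := by
  by_contra! hcon
  obtain ⟨n0, nv, nu, nuv⟩ := hcon
  obtain ⟨b1, b2⟩ := h.mem_box _ hqt
  have s0 := h.sep t ht 0 h0 n0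
  have sv := h.sep t ht v hv nv
  have su := h.sep t ht u hu nu
  have suv := h.sep t ht (u + v) huv nuv
  simp only [hq, Prod.fst_sub, Prod.snd_sub, Prod.fst_add, Prod.snd_add, Prod.smul_fst,
    Prod.smul_snd, smul_eq_mul, Prod.fst_zero, Prod.snd_zero, sub_zero] at b1 b2 s0 suv
  rcases le_total s (1 / 2) with hs | hs
  · exact not_meets_half_parallelogram hv1 hv2 hu1 hu2 hs0 hs hr0 hr1 b1 b2 s0 sv su suv
  · -- the point reflection exchanging the two halves of the parallelogram
    refine not_meets_half_parallelogram (s := 1 - s) (r := 1 - r) (x := u.1 + v.1 - t.1)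
      (y := u.2 + v.2 - t.2) hv1 hv2 hu1 hu2 (by linarith) (by linarith) (by linarith)
      (by linarith) ?_ ?_ ?_ ?_ ?_ ?_
    · rw [← abs_neg]
      convert b1 using 2
      ring
    · rw [← abs_neg]
      convert b2 using 2
      ring
    · rwa [abs_sub_comm, abs_sub_comm (u.2 + v.2)]
    · rw [abs_sub_comm, abs_sub_comm (u.2 + v.2 - t.2)]
      convert su using 3 <;> ring
    · rw [abs_sub_comm, abs_sub_comm (u.2 + v.2 - t.2)]
      convert sv using 3 <;> ring
    · rw [abs_sub_comm, abs_sub_comm (u.2 + v.2 - t.2)]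
      convert s0 using 3 <;> ring

/-- The lattice generated by `u` and `v` is a packing: the squares can overlap only if `i` and `j` are
at most `1` in absolute value, and then `i • u + j • v` is a difference of two of the four vertices. -/
theorem aedisjoint_lattice (h : NearSquareTiling E T) {u v : ℝ × ℝ} (h0 : 0 ∈ T)
    (hv : v ∈ T) (hu : u ∈ T) (huv : u + v ∈ T) (hv1 : |v.1| ≤ 3 / 100)
    (hv2 : |v.2 - 1| ≤ 3 / 100) (hu1 : |u.1 - 1| ≤ 3 / 100) (hu2 : |u.2| ≤ 51 / 100) {i j : ℤ}
    (hij : (i, j) ≠ (0, 0)) : volume {p | p ∈ E ∧ p - (i • u + j • v) ∈ E} = 0 := by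
  rcases Set.eq_empty_or_nonempty {p | p ∈ E ∧ p - (i • u + j • v) ∈ E} with he | ⟨p, hp, hp'⟩
  · rw [he, measure_empty]
  have b := h.mem_box _ hp
  have b' := h.mem_box _ hp'
  rw [← Int.cast_smul_eq_zsmul ℝ, ← Int.cast_smul_eq_zsmul ℝ] at b'
  simp only [Prod.fst_sub, Prod.snd_sub, Prod.fst_add, Prod.snd_add, Prod.smul_fst, Prod.smul_snd,
    smul_eq_mul] at b'
  rw [abs_le, abs_le] at b b'
  have x1 : |(i : ℝ) * u.1 + j * v.1| ≤ 101 / 100 := abs_le.2 ⟨by linarith, by linarith⟩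
  have x2 : |(i : ℝ) * u.2 + j * v.2| ≤ 101 / 100 := abs_le.2 ⟨by linarith, by linarith⟩
  have y1 : |(i : ℝ)| * |u.1| ≤ 101 / 100 + |(j : ℝ)| * |v.1| := by
    rw [← abs_mul, ← abs_mul]
    have := abs_sub (i * u.1 + j * v.1) (j * v.1)
    rw [add_sub_cancel_right] at this
    linarith
  have y2 : |(j : ℝ)| * |v.2| ≤ 101 / 100 + |(i : ℝ)| * |u.2| := by
    rw [← abs_mul, ← abs_mul]
    have := abs_sub (i * u.2 + j * v.2) (i * u.2)
    rw [add_sub_cancel_left] at this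
    linarith
  have hi0 := abs_nonneg (i : ℝ)
  have hj0 := abs_nonneg (j : ℝ)
  have u1 : 97 / 100 ≤ |u.1| := (by linarith [(abs_le.1 hu1).1] : 97 / 100 ≤ u.1).trans (le_abs_self _)
  have v2 : 97 / 100 ≤ |v.2| := (by linarith [(abs_le.1 hv2).1] : 97 / 100 ≤ v.2).trans (le_abs_self _)
  have z1 : |(i : ℝ)| * (97 / 100) ≤ 101 / 100 + |(j : ℝ)| * (3 / 100) := by
    nlinarith [mul_le_mul_of_nonneg_left u1 hi0, mul_le_mul_of_nonneg_left hv1 hj0]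
  have z2 : |(j : ℝ)| * (97 / 100) ≤ 101 / 100 + |(i : ℝ)| * (51 / 100) := by
    nlinarith [mul_le_mul_of_nonneg_left v2 hj0, mul_le_mul_of_nonneg_left hu2 hi0]
  have hi : |i| < 2 := by
    have : |(i : ℝ)| < 2 := by linarith
    exact_mod_cast this
  have hj : |j| < 2 := by
    have : |(j : ℝ)| < 2 := by linarith
    exact_mod_cast this
  have hu1' := abs_le.1 hu1
  have hv1' := abs_le.1 hv1
  have hv2' := abs_le.1 hv2
  have nu : u ≠ 0 := fun h => by norm_num [h] at hu1
  have nv : v ≠ 0 := fun h => by norm_num [h] at hv2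
  have nuv : u + v ≠ 0 := fun h => by
    have := congrArg Prod.fst h
    simp only [Prod.fst_add, Prod.fst_zero] at this
    linarith
  have nuv' : u ≠ v := fun h => by
    rw [h] at hu1'
    linarith
  obtain ⟨hi1, hi2⟩ := abs_lt.1 hi
  obtain ⟨hj1, hj2⟩ := abs_lt.1 hj
  have hi3 : i = -1 ∨ i = 0 ∨ i = 1 := by omega
  have hj3 : j = -1 ∨ j = 0 ∨ j = 1 := by omega
  rcases hi3 with rfl | rfl | rfl <;> rcases hj3 with rfl | rfl | rfl
  · convert h.aedisjoint_sub h0 huv nuv.symm using 6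
    module
  · convert h.aedisjoint_sub h0 hu nu.symm using 6
    module
  · convert h.aedisjoint_sub hv hu nuv'.symm using 6
    module
  · convert h.aedisjoint_sub h0 hv nv.symm using 6
    module
  · exact absurd rfl hij
  · convert h.aedisjoint_sub hv h0 nv using 6
    module
  · convert h.aedisjoint_sub hu hv nuv' using 6
    module
  · convert h.aedisjoint_sub hu h0 nu using 6
    module
  · convert h.aedisjoint_sub huv h0 nuv using 6
    module

/-- Four tiles at the vertices of a parallelogram generate a lattice tiling. It is a packing because
every lattice vector along which the squares overlap is a difference of two vertices, and a covering
because the parallelogram, whose lattice translates cover the plane, is covered by the four tiles. -/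
theorem latticeTiles_of_parallelogram (h : NearSquareTiling E T) {u v : ℝ × ℝ} (h0 : 0 ∈ T)
    (hv : v ∈ T) (hu : u ∈ T) (huv : u + v ∈ T) (hv1 : |v.1| ≤ 3 / 100)
    (hv2 : |v.2 - 1| ≤ 3 / 100) (hu1 : |u.1 - 1| ≤ 3 / 100) (hu2 : |u.2| ≤ 51 / 100) :
    LatticeTiles E := by
  have hdet : u.1 * v.2 - u.2 * v.1 ≠ 0 := by
    rw [abs_le] at hv1 hv2 hu1 hu2
    have : 0 < u.1 * v.2 - u.2 * v.1 := by nlinarith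
    exact this.ne'
  refine ⟨u, v, ?_, fun i j hij => h.aedisjoint_lattice h0 hv hu huv hv1 hv2 hu1 hu2 hij, ?_⟩
  · rw [LinearIndependent.pair_iff]
    intro s t hst
    have e1 := congrArg Prod.fst hst
    have e2 := congrArg Prod.snd hst
    simp only [Prod.fst_add, Prod.snd_add, Prod.smul_fst, Prod.smul_snd, smul_eq_mul,
      Prod.fst_zero, Prod.snd_zero] at e1 e2
    constructor
    · refine (mul_eq_zero.1 ?_).resolve_right hdet
      linear_combination v.2 * e1 - v.1 * e2
    · refine (mul_eq_zero.1 ?_).resolve_right hdet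
      linear_combination u.1 * e2 - u.2 * e1
  · have hall : ∀ᵐ p : ℝ × ℝ, ∀ i j : ℤ, ∃ t ∈ T, p - (i • u + j • v) - t ∈ E := by
      rw [ae_all_iff]
      intro i
      rw [ae_all_iff]
      intro j
      exact (measurePreserving_sub_right volume (i • u + j • v)).quasiMeasurePreserving.ae h.covers
    filter_upwards [hall] with p hp
    -- the coordinates of `p` in the basis `u, v`
    set x := (p.1 * v.2 - p.2 * v.1) / (u.1 * v.2 - u.2 * v.1) with hx
    set y := (u.1 * p.2 - u.2 * p.1) / (u.1 * v.2 - u.2 * v.1) with hy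
    have hxd := div_mul_cancel₀ (p.1 * v.2 - p.2 * v.1) hdet
    have hyd := div_mul_cancel₀ (u.1 * p.2 - u.2 * p.1) hdet
    rw [← hx] at hxd
    rw [← hy] at hyd
    have hpxy : p = x • u + y • v := by
      ext <;> refine mul_right_cancel₀ hdet ?_
      · simp only [Prod.fst_add, Prod.smul_fst, smul_eq_mul]
        linear_combination -u.1 * hxd - v.1 * hyd
      · simp only [Prod.snd_add, Prod.smul_snd, smul_eq_mul]
        linear_combination -u.2 * hxd - v.2 * hyd
    obtain ⟨t, ht, hpt⟩ := hp ⌊x⌋ ⌊y⌋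
    have hq : p - (⌊x⌋ • u + ⌊y⌋ • v) = Int.fract x • u + Int.fract y • v := by
      rw [← Int.self_sub_floor, ← Int.self_sub_floor, sub_smul, sub_smul, Int.cast_smul_eq_zsmul,
        Int.cast_smul_eq_zsmul]
      nth_rewrite 1 [hpxy]
      abel
    rcases h.mem_vertices_of_meets h0 hv hu huv hv1 hv2 hu1 hu2 (Int.fract_nonneg x)
      (Int.fract_lt_one x).le (Int.fract_nonneg y) (Int.fract_lt_one y).le hq ht hpt with
      rfl | rfl | rfl | rfl
    · exact ⟨⌊x⌋, ⌊y⌋, by simpa using hpt⟩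
    · refine ⟨⌊x⌋, ⌊y⌋ + 1, ?_⟩
      convert hpt using 1
      module
    · refine ⟨⌊x⌋ + 1, ⌊y⌋, ?_⟩
      convert hpt using 1
      module
    · refine ⟨⌊x⌋ + 1, ⌊y⌋ + 1, ?_⟩
      convert hpt using 1
      module

theorem latticeTiles_of_quadrilateral (h : NearSquareTiling E T) {u v w : ℝ × ℝ} (h0 : 0 ∈ T)
    (hv : v ∈ T) (hu : u ∈ T) (huw : u + w ∈ T) (hv1 : |v.1| ≤ 3 / 100)
    (hv2 : |v.2 - 1| ≤ 3 / 100) (hu1 : |u.1 - 1| ≤ 3 / 100) (hu2 : |u.2| ≤ 51 / 100)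
    (hw1 : |w.1| ≤ 7 / 100) (hw2 : |w.2 - 1| ≤ 9 / 100) : LatticeTiles E := by
  obtain rfl := h.displacement_eq h0 hv hu huw hv1 hv2 hu1 hu2 hw1 hw2
  exact h.latticeTiles_of_parallelogram h0 hv hu huw hv1 hv2 hu1 hu2

/-! ### Existence of four adjacent tiles -/

theorem exists_right_neighbour (h : NearSquareTiling E T) (h0 : 0 ∈ T) :
    ∃ r ∈ T, 99 / 100 ≤ r.1 ∧ r.1 ≤ 203 / 200 ∧ |r.2| ≤ 101 / 200 := by
  -- a point just outside the right edge of the square around `0`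
  obtain ⟨r, hr, h1, h2⟩ := h.exists_near (51 / 100, 0)
  simp only [zero_sub, abs_neg] at h1 h2
  have h2' := abs_le.1 h2
  rw [abs_le] at h1
  rcases h.sep_cases hr h0 with rfl | h3 | h3 | h3 | h3
  · norm_num at h1
  all_goals
    simp only [Prod.fst_zero, Prod.snd_zero, sub_zero] at h3
    first
    | linarith
    | exact ⟨r, hr, by linarith, by linarith, h2⟩

/-- If the right neighbour `r` of the tile at `0` is shifted downwards, then the tile above `r` is
squeezed against the tile at `0`, and so aligned with `r`; in turn it squeezes the tile above `0`. -/
theorem latticeTiles_of_shifted_down (h : NearSquareTiling E T) (h0 : 0 ∈ T) {r : ℝ × ℝ}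
    (hr : r ∈ T) (hr1 : 99 / 100 ≤ r.1) (hr1' : r.1 ≤ 203 / 200) (hr2 : -(101 / 200) ≤ r.2)
    (hr2' : r.2 < -(3 / 100)) : LatticeTiles E := by
  -- a point just to the right of the tile at `0` and just above `r`
  obtain ⟨t, ht, t1, t2⟩ := h.exists_near (51 / 100, r.2 + 51 / 100)
  simp only [abs_le] at t1 t2
  have ht1 : 99 / 100 ≤ t.1 := by
    rcases h.sep_cases ht h0 with rfl | h3 | h3 | h3 | h3
    · simp only [Prod.fst_zero] at t1
      linarith
    all_goals
      simp only [Prod.fst_zero, Prod.snd_zero, sub_zero] at h3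
      linarith
  have ht2 : 99 / 100 ≤ t.2 - r.2 := by
    rcases h.sep_cases ht hr with rfl | h3 | h3 | h3 | h3 <;> linarith
  -- a point just to the left of `t` and just above the tile at `0`
  obtain ⟨s, hs, s1, s2⟩ := h.exists_near (t.1 - 51 / 100, 51 / 100)
  simp only [abs_le] at s1 s2
  have hs1 : s.1 - t.1 ≤ -(99 / 100) := by
    rcases h.sep_cases hs ht with rfl | h3 | h3 | h3 | h3 <;> linarith
  have hs2 : 99 / 100 ≤ s.2 := by
    rcases h.sep_cases hs h0 with rfl | h3 | h3 | h3 | h3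
    · simp only [Prod.snd_zero] at s2
      linarith
    all_goals
      simp only [Prod.fst_zero, Prod.snd_zero, sub_zero] at h3
      linarith
  refine h.latticeTiles_of_quadrilateral (u := r) (v := s) (w := t - r) h0 hs hr
    (by rwa [add_sub_cancel]) ?_ ?_ ?_ ?_ ?_ ?_ <;>
  · simp only [Prod.fst_sub, Prod.snd_sub, abs_le]
    constructor <;> linarith

theorem latticeTiles_of_shifted (h : NearSquareTiling E T) (h0 : 0 ∈ T) {r : ℝ × ℝ}
    (hr : r ∈ T) (hr1 : 99 / 100 ≤ r.1) (hr1' : r.1 ≤ 203 / 200) (hr2 : |r.2| ≤ 101 / 200)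
    (hr2' : 3 / 100 < |r.2|) : LatticeTiles E := by
  rw [abs_le] at hr2
  rcases lt_abs.1 hr2' with h3 | h3
  · refine LatticeTiles.of_preimage reflection measurePreserving_reflection ?_
    refine h.reflect.latticeTiles_of_shifted_down (r := (r.1, -r.2)) (by simpa using h0) ?_ hr1 hr1'
      (by simp only; linarith) (by simp only; linarith)
    change (r.1, - -r.2) ∈ T
    rwa [neg_neg]
  · exact h.latticeTiles_of_shifted_down h0 hr hr1 hr1' hr2.1 (by linarith)

theorem latticeTiles_of_zero_mem (h : NearSquareTiling E T) (h0 : 0 ∈ T) : LatticeTiles E := by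
  obtain ⟨r, hr, hr1, hr1', hr2⟩ := h.exists_right_neighbour h0
  obtain ⟨s', hs', hs1, hs1', hs2⟩ := h.swap.exists_right_neighbour (by simpa using h0)
  rcases lt_or_ge (3 / 100) |r.2| with hr3 | hr3
  · exact h.latticeTiles_of_shifted h0 hr hr1 hr1' hr2 hr3
  rcases lt_or_ge (3 / 100) |s'.2| with hs3 | hs3
  · exact LatticeTiles.of_preimage (LinearEquiv.prodComm ℝ ℝ ℝ) measurePreserving_prodComm
      (h.swap.latticeTiles_of_shifted (by simpa using h0) hs' hs1 hs1' hs2 hs3)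
  -- both neighbours are aligned with the tile at `0`, and so is their common diagonal neighbour
  obtain ⟨s, rfl⟩ : ∃ s : ℝ × ℝ, s' = s.swap := ⟨s'.swap, by simp⟩
  replace hs' : s ∈ T := hs'
  simp only [Prod.fst_swap, Prod.snd_swap] at hs1 hs1' hs3
  have hr3' := abs_le.1 hr3
  have hs3' := abs_le.1 hs3
  obtain ⟨t, ht, t1, t2⟩ := h.exists_near (55 / 100, 55 / 100)
  simp only [abs_le] at t1 t2
  have key : 96 / 100 ≤ t.1 ∧ 96 / 100 ≤ t.2 := by
    rcases h.sep_cases ht h0 with rfl | h3 | h3 | h3 | h3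
    · norm_num at t1
    all_goals simp only [Prod.fst_zero, Prod.snd_zero, sub_zero] at h3
    · linarith
    · rcases h.sep_cases ht hr with rfl | h4 | h4 | h4 | h4 <;>
        first | linarith | exact ⟨by linarith, by linarith⟩
    · linarith
    · rcases h.sep_cases ht hs' with rfl | h4 | h4 | h4 | h4 <;>
        first | linarith | exact ⟨by linarith, by linarith⟩
  refine h.latticeTiles_of_quadrilateral (u := r) (v := s) (w := t - r) h0 hs' hr
    (by rwa [add_sub_cancel]) hs3 ?_ ?_ (hr3.trans (by norm_num)) ?_ ?_ <;>
  · simp only [Prod.fst_sub, Prod.snd_sub, abs_le]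
    constructor <;> linarith [key.1, key.2]

theorem latticeTiles (h : NearSquareTiling E T) : LatticeTiles E := by
  obtain ⟨c, hc, -⟩ := h.exists_near 0
  exact (h.translate c).latticeTiles_of_zero_mem (by simpa using hc)

end NearSquareTiling

/-! ### Lattices and their duals -/

/-- The image of `ℤⁿ` under `A`, as an additive subgroup. It is encoded as the span of the image of the
standard basis, for which discreteness is known. -/
def latticeSubgroup {n : ℕ} (A : EuclideanSpace ℝ (Fin n) ≃ₗ[ℝ] EuclideanSpace ℝ (Fin n)) :
    AddSubgroup (EuclideanSpace ℝ (Fin n)) :=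
  (Submodule.span ℤ
    (Set.range ((EuclideanSpace.basisFun (Fin n) ℝ).toBasis.map A))).toAddSubgroup

theorem coe_latticeSubgroup {n : ℕ}
    (A : EuclideanSpace ℝ (Fin n) ≃ₗ[ℝ] EuclideanSpace ℝ (Fin n)) :
    (latticeSubgroup A : Set (EuclideanSpace ℝ (Fin n))) =
      A '' {x | ∀ i, ∃ k : ℤ, x i = (k : ℝ)} := by
  ext x
  have : x ∈ latticeSubgroup A ↔
      ∀ i, ((EuclideanSpace.basisFun (Fin n) ℝ).toBasis.map A).repr x i ∈
        Set.range (algebraMap ℤ ℝ) :=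
    Module.Basis.mem_span_iff_repr_mem ℤ _ x
  rw [SetLike.mem_coe, this]
  simp only [Module.Basis.map_repr, LinearEquiv.trans_apply, OrthonormalBasis.coe_toBasis_repr_apply,
    EuclideanSpace.basisFun_repr, Set.mem_range, algebraMap_int_eq, Int.coe_castRingHom]
  constructor
  · intro h
    exact ⟨A.symm x, fun i => (h i).imp fun k hk => hk.symm, A.apply_symm_apply x⟩
  · rintro ⟨y, hy, rfl⟩ i
    simpa [eq_comm] using hy i

theorem mem_latticeSubgroup {n : ℕ}
    {A : EuclideanSpace ℝ (Fin n) ≃ₗ[ℝ] EuclideanSpace ℝ (Fin n)}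
    {x : EuclideanSpace ℝ (Fin n)} :
    x ∈ latticeSubgroup A ↔ ∀ i, ∃ k : ℤ, A.symm x i = k := by
  rw [← SetLike.mem_coe, coe_latticeSubgroup]
  constructor
  · rintro ⟨y, hy, rfl⟩
    simpa using hy
  · exact fun h => ⟨_, h, A.apply_symm_apply x⟩

instance {n : ℕ} (A : EuclideanSpace ℝ (Fin n) ≃ₗ[ℝ] EuclideanSpace ℝ (Fin n)) :
    DiscreteTopology (latticeSubgroup A) :=
  inferInstanceAs (DiscreteTopology (Submodule.span ℤ
    (Set.range ((EuclideanSpace.basisFun (Fin n) ℝ).toBasis.map A))))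

theorem IsFullLattice.discreteTopology {n : ℕ} {L : Set (EuclideanSpace ℝ (Fin n))}
    (h : IsFullLattice L) : DiscreteTopology L := by
  obtain ⟨A, rfl⟩ := h
  rw [← coe_latticeSubgroup]
  exact inferInstanceAs (DiscreteTopology (latticeSubgroup A))

/-- The inverse transpose of `A`: it maps `ℤⁿ` onto the dual of the lattice `A ℤⁿ`. -/
noncomputable def dualEquiv {n : ℕ}
    (A : EuclideanSpace ℝ (Fin n) ≃ₗ[ℝ] EuclideanSpace ℝ (Fin n)) :
    EuclideanSpace ℝ (Fin n) ≃ₗ[ℝ] EuclideanSpace ℝ (Fin n) :=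
  LinearEquiv.ofLinearMap (LinearMap.adjoint A.symm.toLinearMap) (LinearMap.adjoint A.toLinearMap)
    (by rw [← LinearMap.adjoint_comp]; simp)
    (by rw [← LinearMap.adjoint_comp]; simp)

theorem inner_dualEquiv {n : ℕ} (A : EuclideanSpace ℝ (Fin n) ≃ₗ[ℝ] EuclideanSpace ℝ (Fin n))
    (y x : EuclideanSpace ℝ (Fin n)) : inner ℝ (dualEquiv A y) x = inner ℝ y (A.symm x) :=
  LinearMap.adjoint_inner_left A.symm.toLinearMap x y

/-! ### The torus attached to a lattice -/

/-- The projection of `ℝⁿ` onto `ℝⁿ / A ℤⁿ`, identified with the standard torus through `A`. -/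
def latticeProj {n : ℕ} (A : EuclideanSpace ℝ (Fin n) ≃ₗ[ℝ] EuclideanSpace ℝ (Fin n))
    (x : EuclideanSpace ℝ (Fin n)) : UnitAddTorus (Fin n) :=
  fun i => ((A.symm x i : ℝ) : UnitAddCircle)

theorem continuous_latticeProj {n : ℕ}
    (A : EuclideanSpace ℝ (Fin n) ≃ₗ[ℝ] EuclideanSpace ℝ (Fin n)) : Continuous (latticeProj A) := by
  have h : Continuous A.symm := A.symm.toLinearMap.continuous_of_finiteDimensional
  refine continuous_pi fun i => (AddCircle.continuous_mk' (1 : ℝ)).comp ?_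
  fun_prop

theorem expWave_dualEquiv {n : ℕ} (A : EuclideanSpace ℝ (Fin n) ≃ₗ[ℝ] EuclideanSpace ℝ (Fin n))
    (k : Fin n → ℤ) (x : EuclideanSpace ℝ (Fin n)) :
    expWave (dualEquiv A (WithLp.toLp 2 fun i => (k i : ℝ))) x =
      UnitAddTorus.mFourier k (latticeProj A x) := by
  simp only [expWave, inner_dualEquiv, UnitAddTorus.mFourier, latticeProj, ContinuousMap.coe_mk,
    fourier_coe_apply, ← Complex.exp_sum]
  congr 1
  simp only [PiLp.inner_apply, RCLike.inner_apply, conj_trivial]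
  push_cast
  rw [Finset.mul_sum]
  refine Finset.sum_congr rfl fun i _ => ?_
  simp
  ring

theorem dualEquiv_lattice_eq_range {n : ℕ}
    (A : EuclideanSpace ℝ (Fin n) ≃ₗ[ℝ] EuclideanSpace ℝ (Fin n)) :
    dualEquiv A '' {x | ∀ i, ∃ k : ℤ, x i = (k : ℝ)} =
      Set.range fun k : Fin n → ℤ => dualEquiv A (WithLp.toLp 2 fun i => (k i : ℝ)) := by
  refine Set.Subset.antisymm ?_ ?_
  · rintro _ ⟨y, hy, rfl⟩
    choose k hk using hy
    have hy' : y = WithLp.toLp 2 fun i => (k i : ℝ) := by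
      ext i
      exact hk i
    exact ⟨k, by rw [hy']⟩
  · rintro _ ⟨k, rfl⟩
    exact Set.mem_image_of_mem _ (fun i => ⟨k i, rfl⟩)

/-- A measurable section of `latticeProj A`. -/
noncomputable def latticeSection {n : ℕ}
    (A : EuclideanSpace ℝ (Fin n) ≃ₗ[ℝ] EuclideanSpace ℝ (Fin n))
    (z : UnitAddTorus (Fin n)) : EuclideanSpace ℝ (Fin n) :=
  A (WithLp.toLp 2 (UnitAddTorus.measurableEquivPiIoc (fun _ => (0 : ℝ)) z).1)

theorem measurable_latticeSection {n : ℕ}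
    (A : EuclideanSpace ℝ (Fin n) ≃ₗ[ℝ] EuclideanSpace ℝ (Fin n)) :
    Measurable (latticeSection A) := by
  have h : Continuous A := A.toLinearMap.continuous_of_finiteDimensional
  refine h.measurable.comp ((MeasurableEquiv.toLp 2 (Fin n → ℝ)).measurable.comp ?_)
  exact measurable_subtype_coe.comp
    (UnitAddTorus.measurableEquivPiIoc (fun _ : Fin n => (0 : ℝ))).measurable

theorem latticeSection_latticeProj_sub_mem {n : ℕ}
    (A : EuclideanSpace ℝ (Fin n) ≃ₗ[ℝ] EuclideanSpace ℝ (Fin n)) (x : EuclideanSpace ℝ (Fin n)) :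
    latticeSection A (latticeProj A x) - x ∈ latticeSubgroup A := by
  rw [mem_latticeSubgroup]
  intro i
  have h : (((AddCircle.equivIoc 1 (0 : ℝ) ((A.symm x i : ℝ) : UnitAddCircle)) : ℝ) :
      UnitAddCircle) = ((A.symm x i : ℝ) : UnitAddCircle) := AddCircle.coe_equivIoc
  rw [← sub_eq_zero, ← AddCircle.coe_sub, AddCircle.coe_eq_zero_iff] at h
  obtain ⟨k, hk⟩ := h
  refine ⟨k, ?_⟩
  rw [map_sub, latticeSection, A.symm_apply_apply]
  simpa [latticeProj] using hk.symm

/-! ### Lattice tiles are spectral -/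

/-- If every measurable set is, up to a null set, the preimage under `π` of a measurable set,
then every `L²` function is a function of `π`. -/
theorem compMeasurePreserving_surjective_of_preimage {X Y : Type*} [MeasurableSpace X]
    [MeasurableSpace Y] {μ : Measure X} {ν : Measure Y} {π : X → Y} (hπ : MeasurePreserving π μ ν)
    (h : ∀ K, MeasurableSet K → ∃ S, MeasurableSet S ∧ K =ᵐ[μ] π ⁻¹' S) :
    Function.Surjective (Lp.compMeasurePreservingₗᵢ ℂ π hπ : Lp ℂ 2 ν →ₗᵢ[ℂ] Lp ℂ 2 μ) := by
  intro f
  change f ∈ Set.range _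
  induction f using Lp.induction (p := 2) ENNReal.ofNat_ne_top with
  | @indicatorConst c K hK hμK =>
    obtain ⟨S, hS, hKS⟩ := h K hK
    have hνS : ν S ≠ ∞ := by
      rw [← hπ.measure_preimage hS.nullMeasurableSet, ← measure_congr hKS]
      exact hμK.ne
    refine ⟨indicatorConstLp 2 hS hνS c, ?_⟩
    rw [Lp.simpleFunc.coe_indicatorConst]
    refine (Lp.indicatorConstLp_compMeasurePreserving hS hνS c hπ).trans ?_
    refine Lp.ext ?_
    refine (indicatorConstLp_coeFn).trans (.trans ?_ (indicatorConstLp_coeFn).symm)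
    exact indicator_ae_eq_of_ae_eq_set hKS.symm
  | add hf hg _ h1 h2 =>
    obtain ⟨a, ha⟩ := h1
    obtain ⟨b, hb⟩ := h2
    exact ⟨a + b, by rw [map_add, ha, hb]⟩
  | isClosed =>
    exact (LinearIsometry.isometry _).isClosedEmbedding.isClosed_range

theorem IsTiling.isAddFundamentalDomain {n : ℕ} {E : Set (EuclideanSpace ℝ (Fin n))}
    (hE : NullMeasurableSet E volume)
    {A : EuclideanSpace ℝ (Fin n) ≃ₗ[ℝ] EuclideanSpace ℝ (Fin n)}
    (h : IsTiling E (latticeSubgroup A : Set (EuclideanSpace ℝ (Fin n)))) :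
    IsAddFundamentalDomain (latticeSubgroup A) E volume where
  nullMeasurableSet := hE
  ae_covers := by
    have := h.2.2
    filter_upwards [measure_eq_zero_iff_ae_notMem.1 this] with x hx
    rw [Set.notMem_compl_iff, Set.mem_iUnion₂] at hx
    obtain ⟨t, ht, hx⟩ := hx
    rw [Set.mem_vadd_set_iff_neg_vadd_mem] at hx
    exact ⟨⟨-t, neg_mem ht⟩, hx⟩
  aedisjoint := fun a b hab => h.2.1 a a.2 b b.2 (fun h => hab (Subtype.ext h))

theorem expWave_add {n : ℕ} (ξ x y : EuclideanSpace ℝ (Fin n)) :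
    expWave ξ (x + y) = expWave ξ x * expWave ξ y := by
  simp only [expWave, inner_add_right, ← Complex.exp_add]
  push_cast
  ring_nf

/-- A nonconstant character has integral `0` over a fundamental domain: translating the domain
does not change the integral of a periodic function, but multiplies it by a value of the
character. -/
theorem setIntegral_expWave_eq_zero {n : ℕ} {E : Set (EuclideanSpace ℝ (Fin n))}
    {A : EuclideanSpace ℝ (Fin n) ≃ₗ[ℝ] EuclideanSpace ℝ (Fin n)}
    (hE : IsAddFundamentalDomain (latticeSubgroup A) E volume)
    {ξ : EuclideanSpace ℝ (Fin n)} (hξ : ξ ≠ 0)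
    (hper : ∀ l ∈ latticeSubgroup A, expWave ξ l = 1) :
    ∫ x in E, expWave ξ x = 0 := by
  have hcount : Countable (latticeSubgroup A) :=
    TopologicalSpace.separableSpace_iff_countable.1 inferInstance
  -- the character takes the value `-1` at this point
  set y : EuclideanSpace ℝ (Fin n) := (2 * ‖ξ‖ ^ 2)⁻¹ • ξ with hy
  have hy1 : expWave ξ y = -1 := by
    have h : inner ℝ ξ y = 1 / 2 := by
      rw [hy, inner_smul_right, real_inner_self_eq_norm_sq]
      have := norm_ne_zero_iff.2 hξ
      field_simp
    rw [expWave, h, ← Complex.exp_pi_mul_I]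
    congr 1
    push_cast
    ring
  have h1 := (hE.vadd_of_comm y).setIntegral_eq hE (f := expWave ξ) (fun g x => by
    change expWave ξ (g + x) = _
    rw [expWave_add, hper _ g.2, one_mul])
  have h2 : ∫ x in y +ᵥ E, expWave ξ x = ∫ x in E, expWave ξ (y + x) := by
    have hmp : MeasurePreserving (fun x => y + x) (volume : Measure (EuclideanSpace ℝ (Fin n)))
      volume := measurePreserving_add_left _ _
    exact hmp.setIntegral_image_emb (measurableEmbedding_addLeft y) _ E
  rw [h2] at h1
  simp_rw [expWave_add, hy1] at h1
  rw [integral_const_mul] at h1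
  linear_combination (-1 / 2 : ℂ) * h1

theorem continuous_expWave {n : ℕ} (ξ : EuclideanSpace ℝ (Fin n)) : Continuous (expWave ξ) := by
  unfold expWave
  fun_prop

theorem norm_expWave {n : ℕ} (ξ x : EuclideanSpace ℝ (Fin n)) : ‖expWave ξ x‖ = 1 := by
  rw [expWave, show 2 * (Real.pi : ℂ) * Complex.I * ((inner ℝ ξ x : ℝ) : ℂ) =
    ((2 * Real.pi * inner ℝ ξ x : ℝ) : ℂ) * Complex.I by push_cast; ring]
  exact Complex.norm_exp_ofReal_mul_I _

theorem memLp_expWave {n : ℕ} {E : Set (EuclideanSpace ℝ (Fin n))} (hfin : volume E ≠ ∞)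
    (ξ : EuclideanSpace ℝ (Fin n)) : MemLp (expWave ξ) 2 (volume.restrict E) := by
  have : IsFiniteMeasure (volume.restrict E) := ⟨by simpa using hfin.lt_top⟩
  exact MemLp.of_bound (continuous_expWave ξ).aestronglyMeasurable 1
    (.of_forall fun x => (norm_expWave ξ x).le)

theorem conj_expWave_mul {n : ℕ} (ξ η x : EuclideanSpace ℝ (Fin n)) :
    expWave η x * (starRingEnd ℂ) (expWave ξ x) = expWave (η - ξ) x := by
  simp only [expWave, inner_sub_left, ← Complex.exp_conj, ← Complex.exp_add]
  congr 1
  simp only [map_mul, Complex.conj_ofReal, Complex.conj_I, map_ofNat]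
  push_cast
  ring

theorem expWave_dual_lattice {n : ℕ}
    {A : EuclideanSpace ℝ (Fin n) ≃ₗ[ℝ] EuclideanSpace ℝ (Fin n)}
    {l : EuclideanSpace ℝ (Fin n)} (hl : l ∈ latticeSubgroup A) (k : Fin n → ℤ) :
    expWave (dualEquiv A (WithLp.toLp 2 fun i => (k i : ℝ))) l = 1 := by
  rw [mem_latticeSubgroup] at hl
  choose m hm using hl
  have h0 : latticeProj A l = 0 := by
    funext i
    exact (AddCircle.coe_eq_zero_iff (1 : ℝ)).2 ⟨m i, by simp [hm]⟩
  rw [expWave_dualEquiv, h0]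
  simp [UnitAddTorus.mFourier]

/-- A measurable subset of a lattice tile is, up to a null set, the preimage of a measurable subset
of the torus, because `latticeProj` is injective on the tile up to a null set. -/
theorem exists_preimage_latticeProj_ae_eq {n : ℕ} {E : Set (EuclideanSpace ℝ (Fin n))}
    {A : EuclideanSpace ℝ (Fin n) ≃ₗ[ℝ] EuclideanSpace ℝ (Fin n)}
    (hE : IsAddFundamentalDomain (latticeSubgroup A) E volume)
    {K : Set (EuclideanSpace ℝ (Fin n))} (hK : MeasurableSet K) :
    ∃ S, MeasurableSet S ∧ K =ᵐ[volume.restrict E] latticeProj A ⁻¹' S := by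
  have hcount : Countable (latticeSubgroup A) :=
    TopologicalSpace.separableSpace_iff_countable.1 inferInstance
  obtain ⟨E₀, hE₀E, hE₀, hEE₀⟩ := hE.nullMeasurableSet.exists_measurable_subset_ae_eq
  refine ⟨⋃ l : latticeSubgroup A, (fun z => (l : EuclideanSpace ℝ (Fin n)) + latticeSection A z) ⁻¹'
    (K ∩ E₀), MeasurableSet.iUnion fun l =>
      (measurable_latticeSection A).const_add _ (hK.inter hE₀), ?_⟩
  have hmem : ∀ x, x ∈ latticeProj A ⁻¹' (⋃ l : latticeSubgroup A,
      (fun z => (l : EuclideanSpace ℝ (Fin n)) + latticeSection A z) ⁻¹' (K ∩ E₀)) ↔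
      ∃ l : latticeSubgroup A, (l : EuclideanSpace ℝ (Fin n)) + x ∈ K ∩ E₀ := by
    intro x
    simp only [Set.mem_preimage, Set.mem_iUnion]
    have hs := latticeSection_latticeProj_sub_mem A x
    constructor
    · rintro ⟨l, hl⟩
      refine ⟨l + ⟨_, hs⟩, ?_⟩
      rwa [AddSubgroup.coe_add, add_assoc, sub_add_cancel]
    · rintro ⟨l, hl⟩
      refine ⟨l - ⟨_, hs⟩, ?_⟩
      rwa [AddSubgroup.coe_sub, sub_add_eq_add_sub, add_sub_assoc, sub_sub_cancel]
  have hdisj : ∀ᵐ x ∂volume.restrict E, ∀ l : latticeSubgroup A, l ≠ 0 → l +ᵥ x ∉ E := by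
    rw [ae_all_iff]
    intro l
    by_cases hl : l = 0
    · exact .of_forall fun x h => absurd hl h
    · have h := hE.aedisjoint (show -l ≠ 0 by simpa using hl)
      rw [ae_restrict_iff'₀ hE.nullMeasurableSet]
      filter_upwards [measure_eq_zero_iff_ae_notMem.1 h] with x hx hxE _ hlx
      refine hx ⟨?_, by simpa using hxE⟩
      rw [Set.mem_vadd_set_iff_neg_vadd_mem]
      simpa using hlx
  have hE₀' : ∀ᵐ x ∂volume.restrict E, x ∈ E₀ := by
    rw [← Measure.restrict_congr_set hEE₀]
    exact ae_restrict_mem hE₀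
  rw [Filter.eventuallyEq_set]
  filter_upwards [hdisj, hE₀'] with x hx hx₀
  rw [hmem]
  constructor
  · exact fun hxK => ⟨0, by simpa using ⟨hxK, hx₀⟩⟩
  · rintro ⟨l, hl⟩
    by_cases h0 : l = 0
    · subst h0
      simpa using hl.1
    · exact absurd (hE₀E hl.2) (hx l h0)

/-- The easy direction of Fuglede's conjecture: a set that tiles with a lattice has the dual lattice
as a spectrum. -/
theorem AdmitsLatticeTiling.isSpectral {n : ℕ} {E : Set (EuclideanSpace ℝ (Fin n))}
    (hE : NullMeasurableSet E volume) (hpos : volume E ≠ 0) (hfin : volume E ≠ ∞)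
    (h : AdmitsLatticeTiling E) : IsSpectral E := by
  obtain ⟨_, ⟨A, rfl⟩, h⟩ := h
  rw [← coe_latticeSubgroup] at h
  have hF := h.isAddFundamentalDomain hE
  have : IsFiniteMeasure (volume.restrict E) := ⟨by simpa using hfin.lt_top⟩
  have : NeZero (volume.restrict E) := ⟨by simpa using hpos⟩
  set freq : (Fin n → ℤ) → EuclideanSpace ℝ (Fin n) :=
    fun k => dualEquiv A (WithLp.toLp 2 fun i => (k i : ℝ)) with hfreq
  refine ⟨Set.range freq, ?_, fun ξ => memLp_expWave hfin _, ?_, ?_, ?_⟩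
  · exact IsFullLattice.discreteTopology ⟨dualEquiv A, (dualEquiv_lattice_eq_range A).symm⟩
  · intro ξ h0
    have h1 := (memLp_expWave hfin (ξ : EuclideanSpace ℝ (Fin n))).coeFn_toLp
    rw [h0] at h1
    obtain ⟨x, hx⟩ := (h1.symm.trans (Lp.coeFn_zero ℂ 2 _)).exists
    have := norm_expWave (ξ : EuclideanSpace ℝ (Fin n)) x
    rw [hx] at this
    simp at this
  · rintro ⟨_, k, rfl⟩ ⟨_, m, rfl⟩ hkm
    have hkm' : freq m - freq k ≠ 0 := fun h => hkm (Subtype.ext (sub_eq_zero.1 h).symm)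
    rw [L2.inner_def, ← setIntegral_expWave_eq_zero hF hkm']
    · refine integral_congr_ae ?_
      filter_upwards [(memLp_expWave hfin (freq k)).coeFn_toLp,
        (memLp_expWave hfin (freq m)).coeFn_toLp] with x h1 h2
      rw [h1, h2, RCLike.inner_apply, conj_expWave_mul]
    · intro l hl
      rw [← conj_expWave_mul, expWave_dual_lattice hl, expWave_dual_lattice hl]
      simp
  · set ν := (volume.restrict E).map (latticeProj A) with hν
    have hπ : MeasurePreserving (latticeProj A) (volume.restrict E) ν :=
      (continuous_latticeProj A).measurable.measurePreserving _
    have : IsFiniteMeasure ν := by rw [hν]; infer_instance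
    set Φ : C(UnitAddTorus (Fin n), ℂ) →L[ℂ] Lp ℂ 2 (volume.restrict E) :=
      (Lp.compMeasurePreservingₗᵢ ℂ (latticeProj A) hπ).toContinuousLinearMap.comp
        (ContinuousMap.toLp 2 ν ℂ) with hΦ
    have hdense : DenseRange Φ := by
      have hsurj := compMeasurePreserving_surjective_of_preimage hπ
        fun K hK => exists_preimage_latticeProj_ae_eq hF hK
      exact hsurj.denseRange.comp
        (ContinuousMap.toLp_denseRange (p := 2) ℂ ν ℂ ENNReal.ofNat_ne_top)
        (LinearIsometry.continuous _)
    have hclosure := hdense.topologicalClosure_map_submodule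
      (UnitAddTorus.span_mFourier_closure_eq_top (d := Fin n))
    rw [Submodule.map_span] at hclosure
    convert hclosure using 3
    rw [← Set.range_comp]
    have hval : ∀ k : Fin n → ℤ, Φ (UnitAddTorus.mFourier k) =
        (memLp_expWave hfin (freq k)).toLp := by
      intro k
      refine Lp.ext ?_
      refine ((Lp.coeFn_compMeasurePreserving _ hπ).trans
        (hπ.quasiMeasurePreserving.ae_eq_comp (ContinuousMap.coeFn_toLp (𝕜 := ℂ) ν _))).trans ?_
      filter_upwards [(memLp_expWave hfin (freq k)).coeFn_toLp] with x hx
      rw [hx, Function.comp_apply, hfreq, expWave_dualEquiv]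
    ext f
    constructor
    · rintro ⟨⟨_, k, rfl⟩, rfl⟩
      exact ⟨k, hval k⟩
    · rintro ⟨k, rfl⟩
      exact ⟨⟨_, k, rfl⟩, (hval k).symm⟩

/-! ### From near-squares in the Euclidean plane to coordinates -/

/-- Two essentially disjoint translates of a set of area `1` inside a square of side `1 + ε` are at
sup distance at least `0.99`: otherwise the intersection of the two squares is larger than the part
of their total area which the sets leave free. -/
theorem sup_norm_separation {E : Set (ℝ × ℝ)} (hE : NullMeasurableSet E volume)
    (hvol : volume E = 1) {ε : ℝ} (hε0 : 0 < ε) (hε : ε < 1 / 100000)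
    (hbox : ∀ p ∈ E, |p.1| ≤ (1 + ε) / 2 ∧ |p.2| ≤ (1 + ε) / 2) {s t : ℝ × ℝ}
    (hst : volume {p | p - s ∈ E ∧ p - t ∈ E} = 0) :
    99 / 100 ≤ |s.1 - t.1| ∨ 99 / 100 ≤ |s.2 - t.2| := by
  by_contra! hcon
  set Q : ℝ × ℝ → Set (ℝ × ℝ) := fun c =>
    Set.Icc (c.1 - (1 + ε) / 2) (c.1 + (1 + ε) / 2) ×ˢ
      Set.Icc (c.2 - (1 + ε) / 2) (c.2 + (1 + ε) / 2) with hQ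
  have hQmeas : ∀ c, MeasurableSet (Q c) := fun c => measurableSet_Icc.prod measurableSet_Icc
  have hQfin : ∀ c, volume (Q c) ≠ ∞ := fun c =>
    (isCompact_Icc.prod isCompact_Icc).measure_ne_top
  have hQvol : ∀ c, volume.real (Q c) = (1 + ε) ^ 2 := by
    intro c
    rw [hQ, Measure.volume_eq_prod, measureReal_prod_prod,
      Real.volume_real_Icc_of_le (by linarith), Real.volume_real_Icc_of_le (by linarith)]
    ring
  have hsub : ∀ c, {p | p - c ∈ E} ⊆ Q c := by
    intro c p hp
    have := hbox _ hp
    simp only [Prod.fst_sub, Prod.snd_sub, abs_le] at this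
    exact ⟨⟨by linarith, by linarith⟩, by linarith, by linarith⟩
  have hEvol : ∀ c, volume {p | p - c ∈ E} = 1 := by
    intro c
    rw [← hvol, ← measure_preimage_add_right volume (-c) E]
    simp only [← sub_eq_add_neg]
    rfl
  have hEmeas : NullMeasurableSet {p | p - t ∈ E} volume :=
    hE.preimage (measurePreserving_sub_right volume t).quasiMeasurePreserving
  have hunion : (2 : ℝ) ≤ volume.real (Q s ∪ Q t) := by
    have h2 : volume ({p | p - s ∈ E} ∪ {p | p - t ∈ E}) = 2 := by
      have hd : AEDisjoint volume {p | p - s ∈ E} {p | p - t ∈ E} := hst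
      rw [measure_union₀ hEmeas hd, hEvol, hEvol, one_add_one_eq_two]
    have := ENNReal.toReal_mono (measure_union_ne_top (hQfin s) (hQfin t))
      (measure_mono (Set.union_subset_union (hsub s) (hsub t)))
    rwa [h2, ENNReal.toReal_ofNat] at this
  have hinter : (1 / 100 : ℝ) ^ 2 ≤ volume.real (Q s ∩ Q t) := by
    rw [hQ, Set.prod_inter_prod, Set.Icc_inter_Icc, Set.Icc_inter_Icc, Measure.volume_eq_prod,
      measureReal_prod_prod, sq]
    have hlen : ∀ a b : ℝ, |a - b| < 99 / 100 → 1 / 100 ≤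
        volume.real (Set.Icc ((a - (1 + ε) / 2) ⊔ (b - (1 + ε) / 2))
          ((a + (1 + ε) / 2) ⊓ (b + (1 + ε) / 2))) := by
      intro a b hab
      rw [abs_lt] at hab
      rw [Real.volume_real_Icc]
      refine le_max_of_le_left ?_
      rcases le_total a b with h | h
      · rw [max_eq_right (by linarith), min_eq_left (by linarith)]
        linarith
      · rw [max_eq_left (by linarith), min_eq_right (by linarith)]
        linarith
    exact mul_le_mul (hlen _ _ hcon.1) (hlen _ _ hcon.2) (by norm_num) measureReal_nonneg
  have hsum := measureReal_union_add_inter (μ := volume) (s := Q s) (hQmeas t) (hQfin s) (hQfin t)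
  rw [hQvol, hQvol] at hsum
  nlinarith

theorem LatticeTiles.of_translate {V : Type*} [NormedAddCommGroup V] [NormedSpace ℝ V]
    [MeasureSpace V] [BorelSpace V] [(volume : Measure V).IsAddHaarMeasure] [SecondCountableTopology V]
    {E : Set V} (c : V) (h : LatticeTiles {p | p + c ∈ E}) : LatticeTiles E := by
  obtain ⟨u, v, huv, hd, hc⟩ := h
  have hmp := (measurePreserving_sub_right (volume : Measure V) c).quasiMeasurePreserving
  refine ⟨u, v, huv, fun i j hij => ?_, ?_⟩
  · convert hmp.preimage_null (hd i j hij) using 2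
    ext p
    simp [sub_right_comm p c]
  · filter_upwards [hmp.ae hc] with p ⟨i, j, hp⟩
    exact ⟨i, j, by simpa [sub_right_comm p c] using hp⟩

theorem LatticeTiles.admitsLatticeTiling {E : Set (EuclideanSpace ℝ (Fin 2))}
    (h : LatticeTiles E) : AdmitsLatticeTiling E := by
  obtain ⟨u, v, huv, hd, hc⟩ := h
  set b := basisOfLinearIndependentOfCardEqFinrank huv (by simp) with hb
  set A : EuclideanSpace ℝ (Fin 2) ≃ₗ[ℝ] EuclideanSpace ℝ (Fin 2) :=
    (WithLp.linearEquiv 2 ℝ (Fin 2 → ℝ)).trans b.equivFun.symm with hA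
  have hAx : ∀ x, A x = x 0 • u + x 1 • v := by
    intro x
    rw [hA, LinearEquiv.trans_apply, Module.Basis.equivFun_symm_apply, Fin.sum_univ_two]
    simp [hb]
  set L := A '' {x | ∀ i, ∃ k : ℤ, x i = (k : ℝ)} with hL
  have hmemL : ∀ x, x ∈ L ↔ ∃ i j : ℤ, x = i • u + j • v := by
    intro x
    constructor
    · rintro ⟨y, hy, rfl⟩
      obtain ⟨i, hi⟩ := hy 0
      obtain ⟨j, hj⟩ := hy 1
      exact ⟨i, j, by rw [hAx, hi, hj, Int.cast_smul_eq_zsmul, Int.cast_smul_eq_zsmul]⟩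
    · rintro ⟨i, j, rfl⟩
      refine ⟨WithLp.toLp 2 ![(i : ℝ), (j : ℝ)], ?_, ?_⟩
      · intro k
        fin_cases k
        · exact ⟨i, rfl⟩
        · exact ⟨j, rfl⟩
      · rw [hAx, ← Int.cast_smul_eq_zsmul ℝ, ← Int.cast_smul_eq_zsmul ℝ]
        rfl
  have hfull : IsFullLattice L := ⟨A, rfl⟩
  refine ⟨L, hfull, hfull.discreteTopology, ?_, ?_⟩
  · intro s hs t ht hst
    obtain ⟨i, j, rfl⟩ := (hmemL s).1 hs
    obtain ⟨i', j', rfl⟩ := (hmemL t).1 ht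
    have hij : (i' - i, j' - j) ≠ (0, 0) := by
      intro h
      simp only [Prod.mk.injEq, sub_eq_zero] at h
      exact hst (by rw [h.1, h.2])
    have h0 := (measurePreserving_sub_right volume (i • u + j • v)).quasiMeasurePreserving.preimage_null
      (hd _ _ hij)
    refine measure_mono_null ?_ h0
    rintro p ⟨hp1, hp2⟩
    rw [Set.mem_vadd_set_iff_neg_vadd_mem, vadd_eq_add, neg_add_eq_sub] at hp1 hp2
    refine ⟨hp1, ?_⟩
    convert hp2 using 1
    module
  · refine measure_mono_null ?_ (ae_iff.1 hc)
    rintro p hp ⟨i, j, hpE⟩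
    refine hp (Set.mem_biUnion ((hmemL (i • u + j • v)).2 ⟨i, j, rfl⟩) ?_)
    rwa [Set.mem_vadd_set_iff_neg_vadd_mem, vadd_eq_add, neg_add_eq_sub]

/-- The identification of the coordinate plane with the Euclidean plane. -/
noncomputable def planeEquiv : (ℝ × ℝ) ≃ₗ[ℝ] EuclideanSpace ℝ (Fin 2) :=
  (LinearEquiv.finTwoArrow ℝ ℝ).symm.trans (WithLp.linearEquiv 2 ℝ (Fin 2 → ℝ)).symm

theorem measurePreserving_planeEquiv : MeasurePreserving planeEquiv :=
  (PiLp.volume_preserving_toLp (Fin 2)).comp (volume_preserving_finTwoArrow ℝ).symm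

theorem measurePreserving_planeEquiv_symm : MeasurePreserving planeEquiv.symm :=
  (volume_preserving_finTwoArrow ℝ).comp (PiLp.volume_preserving_ofLp (Fin 2))

theorem admitsLatticeTiling_of_tilesByTranslations {E : Set (EuclideanSpace ℝ (Fin 2))} {ε : ℝ}
    (hε0 : 0 < ε) (hε : ε < 1 / 100000) (hE : NullMeasurableSet E volume) (hvol : volume E = 1)
    (hQ : ∃ Q, IsPlaneSquare (1 + ε) Q ∧ E ⊆ Q) (hT : TilesByTranslations E) :
    AdmitsLatticeTiling E := by
  obtain ⟨_, ⟨φ, rfl⟩, hEQ⟩ := hQ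
  obtain ⟨T, hdisc, hdisj, hcov⟩ := hT
  -- by Mazur-Ulam `φ` is a linear isometry followed by a translation
  set ψ := φ.toRealAffineIsometryEquiv with hψ
  set g : (ℝ × ℝ) ≃ₗ[ℝ] EuclideanSpace ℝ (Fin 2) :=
    planeEquiv.trans ψ.linearIsometryEquiv.toLinearEquiv with hg
  set m : ℝ × ℝ := ((1 + ε) / 2, (1 + ε) / 2) with hm
  set c := φ (planeEquiv m) with hc
  have hgc : ∀ p, g p + c = φ (planeEquiv (p + m)) := by
    intro p
    have := ψ.map_vadd (planeEquiv m) (planeEquiv p)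
    rw [hψ, IsometryEquiv.coeFn_toRealAffineIsometryEquiv] at this
    rw [map_add]
    exact this.symm
  have hgmp : MeasurePreserving g :=
    ψ.linearIsometryEquiv.measurePreserving.comp measurePreserving_planeEquiv
  have hgmp' : MeasurePreserving g.symm :=
    measurePreserving_planeEquiv_symm.comp ψ.linearIsometryEquiv.symm.measurePreserving
  have hgcmp : MeasurePreserving fun p => g p + c :=
    (measurePreserving_add_right volume c).comp hgmp
  have hE' : NullMeasurableSet {p | g p + c ∈ E} volume :=
    hE.preimage hgcmp.quasiMeasurePreserving
  have hvol' : volume {p | g p + c ∈ E} = 1 := by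
    rw [← hvol]
    exact hgcmp.measure_preimage hE
  have hbox : ∀ p ∈ {p | g p + c ∈ E}, |p.1| ≤ (1 + ε) / 2 ∧ |p.2| ≤ (1 + ε) / 2 := by
    intro p hp
    obtain ⟨y, hy, hyp⟩ := hEQ hp
    rw [hgc] at hyp
    obtain rfl := φ.injective hyp
    have h0 : p.1 + (1 + ε) / 2 ∈ Set.Icc 0 (1 + ε) := hy 0
    have h1 : p.2 + (1 + ε) / 2 ∈ Set.Icc 0 (1 + ε) := hy 1
    rw [Set.mem_Icc] at h0 h1
    exact ⟨abs_le.2 ⟨by linarith, by linarith⟩, abs_le.2 ⟨by linarith, by linarith⟩⟩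
  have hdisj' : ∀ s ∈ g ⁻¹' T, ∀ t ∈ g ⁻¹' T, s ≠ t →
      volume {p | p - s ∈ {p | g p + c ∈ E} ∧ p - t ∈ {p | g p + c ∈ E}} = 0 := by
    intro s hs t ht hst
    convert hgcmp.quasiMeasurePreserving.preimage_null
      (hdisj (g s) hs (g t) ht (g.injective.ne hst)) using 2
    ext p
    simp only [Set.mem_preimage, Set.mem_inter_iff, Set.mem_vadd_set_iff_neg_vadd_mem, vadd_eq_add,
      neg_add_eq_sub, add_sub_right_comm, ← map_sub]
    rfl
  have hnear : NearSquareTiling {p | g p + c ∈ E} (g ⁻¹' T) :=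
    { nullMeasurableSet := hE'
      mem_box := fun p hp => by
        have := hbox p hp
        exact ⟨this.1.trans (by linarith), this.2.trans (by linarith)⟩
      countable := by
        have : Countable T := TopologicalSpace.separableSpace_iff_countable.1 inferInstance
        exact (Set.to_countable T).preimage g.injective
      sep := fun s hs t ht hst =>
        sup_norm_separation hE' hvol' hε0 hε hbox (hdisj' s hs t ht hst)
      aedisjoint := hdisj'
      covers := by
        filter_upwards [hgcmp.quasiMeasurePreserving.ae (measure_eq_zero_iff_ae_notMem.1 hcov)]
          with p hp
        rw [Set.notMem_compl_iff, Set.mem_iUnion₂] at hp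
        obtain ⟨t, ht, hp⟩ := hp
        rw [Set.mem_vadd_set_iff_neg_vadd_mem, vadd_eq_add, neg_add_eq_sub] at hp
        refine ⟨g.symm t, by simpa using ht, ?_⟩
        rwa [map_sub, g.apply_symm_apply, ← add_sub_right_comm] }
  have hlat : LatticeTiles {q : EuclideanSpace ℝ (Fin 2) | q + c ∈ E} :=
    LatticeTiles.of_preimage g hgmp' hnear.latticeTiles
  exact hlat.of_translate.admitsLatticeTiling

theorem corollary3 :
    ∃ ε₀ : ℝ, 0 < ε₀ ∧ ∀ ε : ℝ, 0 < ε → ε < ε₀ →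
      ∀ E : Set (EuclideanSpace ℝ (Fin 2)),
        NullMeasurableSet E volume →
        volume E = 1 →
        (∃ Q : Set (EuclideanSpace ℝ (Fin 2)), IsPlaneSquare (1 + ε) Q ∧ E ⊆ Q) →
        TilesByTranslations E →
        AdmitsLatticeTiling E ∧ IsSpectral E := by
  -- `4 ε + 2 ε ^ 2 < (1 / 100) ^ 2` is what the separation by `0.99` needs
  refine ⟨1 / 100000, by norm_num, fun ε hε0 hε E hE hvol hQ hT => ?_⟩
  have h := admitsLatticeTiling_of_tilesByTranslations hε0 hε hE hvol hQ hT
  exact ⟨h, h.isSpectral hE (by simp [hvol]) (by simp [hvol])⟩
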